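/- Let $R$ be a finite (associative, unital, not necessarily commutative) Frobenius ring, i.e. a finite ring for which there is a character $\chi\in\mathrm{Hom}_{\mathbb Z}(R,\mathbb C^\times)$ of its additive group whose kernel contains no nonzero left (equivalently, no nonzero right) ideal of $R$. For any such $\chi$, let $$\mathrm{w}_{\mathrm{hom}}(x)=1-\frac{1}{|R^\times|}\sum_{u\in R^\times}\chi(ux)\qquad(x\in R)$$ be the normalized homogeneous weight $\mathrm{w}_{\mathrm{hom}}\colon R\to\mathbb C$. Let $Rs_1,\dots,Rs_\tau$ ($\tau\ge 0$) be the different left ideals of $R$ of order $2$, with generators $s_1,\dots,s_\tau$ (each $s_i$ is the unique nonzero element of $Rs_i$), and let $$S_0=\Bigl\{\sum_{i\in J}s_i : J\subseteq\{1,\dots,\tau\},\ |J|\text{ even}\Bigr\}.$$ Then $\mathrm{w}_{\mathrm{hom}}(x)$ is real and $\mathrm{w}_{\mathrm{hom}}(x)\ge 0$ for all $x\in R$; $S_0=\{x\in R : \mathrm{w}_{\mathrm{hom}}(x)=0\}$; and $\mathrm{w}_{\mathrm{hom}}(x+y)=\mathrm{w}_{\mathrm{hom}}(x)$ for all $x\in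 R$ and $y\in S_0$. -/

import Mathlib

/-- A character of the additive group of `R` is *generating* if its kernel contains no nonzero
left ideal, or contains no nonzero right ideal, of `R` (for finite `R` the two conditions are
equivalent). In Mathlib `Ideal R` is the type of left ideals of a ring; right ideals are the
`Rᵐᵒᵖ`-submodules of `R`. A finite ring is a Frobenius ring iff such a character exists. -/
def IsGeneratingCharacter {R : Type*} [Ring R] (χ : AddChar R ℂ) : Prop :=
  (∀ I : Ideal R, (∀ x ∈ I, χ x = 1) → I = ⊥) ∨
  (∀ I : Submodule Rᵐᵒᵖ R, (∀ x ∈ I, χ x = 1) → I = ⊥)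

/-- The normalized homogeneous weight
`w(x) = 1 - (1 / |Rˣ|) ∑_{u ∈ Rˣ} χ(u x)` of a finite Frobenius ring `R`,
computed from a generating character `χ`. -/
noncomputable def homWeight {R : Type*} [Ring R] (χ : AddChar R ℂ) (x : R) : ℂ :=
  1 - 1 / (Nat.card Rˣ : ℂ) * ∑ᶠ u : Rˣ, χ ((u : R) * x)

/-- The elements `s` whose left ideal `R s` has order `2`, i.e. the (unique) generators
`s₁, …, s_τ` of the left ideals of order `2`. -/
def orderTwoGenerators (R : Type*) [Ring R] : Set R :=
  {s | Nat.card (Ideal.span {s} : Ideal R) = 2}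

/-- The set `S₀` of all sums of an even number of (distinct) elements of `{s₁, …, s_τ}`. -/
def evenSums (R : Type*) [Ring R] : Set R :=
  {x | ∃ T : Finset R, (T : Set R) ⊆ orderTwoGenerators R ∧ Even T.card ∧ ∑ s ∈ T, s = x}

open scoped ComplexConjugate

/-! The real part of the weight is a mean over units of `1 - Re χ(ux) ≥ 0`, so the weight vanishes
iff `χ(ux) = 1` for every unit `u`; then `χ` is trivial on `unitSpan R * x`. The crux is that
`unitSpan R` contains the two-sided ideal generated by all `a * a - a`
(`mul_mul_self_sub_self_mul_mem`). As `χ` is generating, this ideal kills `x`, so `R` acts on `Rx`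
through a Boolean ring and `x` is a sum of distinct `s_i`. Since `χ(s_i) = -1`, their number is
even. Conversely, units fix every `s_i`. -/

/-- In a finite ring every element is the sum of a unit and an idempotent commuting with it. -/
theorem exists_isIdempotentElem_commute_isUnit_sub {R : Type*} [Ring R] [Finite R] (a : R) :
    ∃ e : R, e * e = e ∧ a * e = e * a ∧ IsUnit (a - e) := by
  obtain ⟨n, hn, hf⟩ : ∃ n : ℕ, 0 < n ∧ a ^ n * a ^ n = a ^ n := by
    obtain ⟨i, j, hij, h⟩ : ∃ i j : ℕ, i < j ∧ a ^ i = a ^ j := by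
      obtain ⟨i, j, hij, h⟩ := Finite.exists_ne_map_eq_of_infinite (fun n : ℕ => a ^ n)
      rcases lt_or_gt_of_ne hij with h' | h'
      · exact ⟨i, j, h', h⟩
      · exact ⟨j, i, h', h.symm⟩
    obtain ⟨p, hp, rfl⟩ : ∃ p, 0 < p ∧ j = i + p := ⟨j - i, by omega, by omega⟩
    have step : ∀ k, a ^ (i + k * p) = a ^ i := by
      intro k
      induction k with
      | zero => simp
      | succ k ih =>
        rw [show i + (k + 1) * p = (i + k * p) + p by ring, pow_add, ih, ← pow_add, ← h]
    -- A multiple of the period that is at least `i`, and positive even when `i = 0`.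
    refine ⟨(i + 1) * p, by positivity, ?_⟩
    have hle : i ≤ (i + 1) * p := by nlinarith
    obtain ⟨q, hq⟩ := Nat.exists_eq_add_of_le hle
    calc a ^ ((i + 1) * p) * a ^ ((i + 1) * p)
        = a ^ (i + (i + 1) * p) * a ^ q := by
          rw [← pow_add, ← pow_add]; congr 1; omega
      _ = a ^ ((i + 1) * p) := by rw [step, ← pow_add, ← hq]
  have hcomm : a * a ^ n = a ^ n * a := (Commute.refl a).pow_right n
  refine ⟨1 - a ^ n, ?_, ?_, ?_⟩
  · simp [mul_sub, sub_mul, hf]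
  · simp [mul_sub, sub_mul, hcomm]
  -- On the image of `a ^ n` the factor acts as `a`, injective there; on the complement it acts as
  -- `a - 1` with `a` nilpotent.
  · have hinj : Function.Injective fun y => (a - (1 - a ^ n)) * y := by
      intro y₁ y₂ h
      rw [← sub_eq_zero]
      have hy : (a - (1 - a ^ n)) * (y₁ - y₂) = 0 := by
        rw [mul_sub _ y₁]
        exact sub_eq_zero.mpr h
      generalize y₁ - y₂ = y at hy ⊢
      have h1 : a * (a ^ n * y) = 0 := by
        have : a ^ n * ((a - (1 - a ^ n)) * y) = a * (a ^ n * y) := by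
          rw [← mul_assoc, ← mul_assoc, hcomm, mul_sub, mul_sub, hf]
          simp
        rw [← this, hy, mul_zero]
      have h2 : a ^ n * y = 0 := by
        rw [← hf, mul_assoc]
        generalize a ^ n * y = z at h1 ⊢
        obtain ⟨m, rfl⟩ := Nat.exists_eq_succ_of_ne_zero hn.ne'
        rw [pow_succ, mul_assoc, h1, mul_zero]
      have h3 : a * y = y := by
        have : a * y - (y - a ^ n * y) = 0 := by rw [← hy]; noncomm_ring
        rw [h2, sub_zero] at this
        exact sub_eq_zero.mp this
      have h4 : ∀ k, a ^ k * y = y := by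
        intro k
        induction k with
        | zero => simp
        | succ k ih => rw [pow_succ, mul_assoc, h3, ih]
      rw [← h4 n, h2]
    obtain ⟨v, hv⟩ := (Finite.injective_iff_surjective.mp hinj) 1
    exact IsUnit.of_mul_eq_one v hv

/-! ### The additive span of the units -/

/-- The additive subgroup generated by the units of a ring. -/
def unitSpan (R : Type*) [Ring R] : AddSubgroup R :=
  AddSubgroup.closure {u | IsUnit u}

namespace unitSpan

variable {R : Type*} [Ring R]

theorem mem_of_isUnit {u : R} (hu : IsUnit u) : u ∈ unitSpan R :=
  AddSubgroup.subset_closure hu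

theorem isUnit_one_add_of_mul_self_eq_zero {x : R} (hx : x * x = 0) : IsUnit (1 + x) :=
  IsNilpotent.isUnit_one_add ⟨2, by rw [pow_two, hx]⟩

theorem mem_of_mul_self_eq_zero {x : R} (hx : x * x = 0) : x ∈ unitSpan R := by
  have := (unitSpan R).sub_mem (mem_of_isUnit (isUnit_one_add_of_mul_self_eq_zero hx))
    (mem_of_isUnit isUnit_one)
  simpa using this

theorem mul_mem_of_mul_self_eq_zero {x y : R} (hx : x * x = 0) (hy : y * y = 0) :
    x * y ∈ unitSpan R := by
  have h := (unitSpan R).sub_mem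
    (mem_of_isUnit ((isUnit_one_add_of_mul_self_eq_zero hx).mul
      (isUnit_one_add_of_mul_self_eq_zero hy)))
    ((unitSpan R).add_mem ((unitSpan R).add_mem (mem_of_isUnit isUnit_one)
      (mem_of_mul_self_eq_zero hx)) (mem_of_mul_self_eq_zero hy))
  have e : (1 + x) * (1 + y) - (1 + x + y) = x * y := by noncomm_ring
  rwa [e] at h

theorem mul_mem_of_isUnit {u g : R} (hu : IsUnit u) (hg : g ∈ unitSpan R) :
    u * g ∈ unitSpan R := by
  induction hg using AddSubgroup.closure_induction with
  | mem v hv => exact mem_of_isUnit (hu.mul hv)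
  | zero => simp
  | add a b _ _ ha hb => rw [mul_add]; exact add_mem ha hb
  | neg a _ ha => rw [mul_neg]; exact neg_mem ha

/-- With `a = e + u`, one has `a² - a = (2e - 1)u + u²`, and `2e - 1` is an involution. -/
theorem mul_self_sub_self_mem [Finite R] (a : R) : a * a - a ∈ unitSpan R := by
  obtain ⟨e, he, hc, hu⟩ := exists_isIdempotentElem_commute_isUnit_sub a
  have h1 : IsUnit (2 * e - 1) := by
    refine IsUnit.of_mul_eq_one (2 * e - 1) ?_
    calc (2 * e - 1) * (2 * e - 1) = 4 * (e * e) - 4 * e + 1 := by noncomm_ring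
      _ = 1 := by rw [he]; simp
  have h := add_mem (mem_of_isUnit (h1.mul hu)) (mem_of_isUnit (hu.mul hu))
  have key : (2 * e - 1) * (a - e) + (a - e) * (a - e) = a * a - a := by
    calc (2 * e - 1) * (a - e) + (a - e) * (a - e)
        = a * a - a + (e * a - a * e) + (e - e * e) := by noncomm_ring
      _ = a * a - a := by rw [he, hc]; simp
  rwa [key] at h

theorem mul_add_mul_mem [Finite R] (a b : R) : a * b + b * a ∈ unitSpan R := by
  have h := sub_mem (sub_mem (mul_self_sub_self_mem (a + b)) (mul_self_sub_self_mem a))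
    (mul_self_sub_self_mem b)
  have e : (a + b) * (a + b) - (a + b) - (a * a - a) - (b * b - b) = a * b + b * a := by
    noncomm_ring
  rwa [e] at h

theorem mul_sub_mul_mem [Finite R] (a b : R) : a * b - b * a ∈ unitSpan R := by
  -- For `c = ba`, the difference of `c² - c` and `(-c)² - (-c)` is `-2c`, which turns `ab + ba`
  -- into `ab - ba`.
  have h := add_mem (mul_add_mul_mem a b) (sub_mem (mul_self_sub_self_mem (b * a))
    (mul_self_sub_self_mem (-(b * a))))
  have e : a * b + b * a + (b * a * (b * a) - b * a - (-(b * a) * -(b * a) - -(b * a)))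
      = a * b - b * a := by
    noncomm_ring
  rwa [e] at h

/-- Peirce decomposition: off-diagonal corners square to zero, and the corner `f(a² - a)f` is
`(faf)² - faf` plus a product of two off-diagonal elements. -/
theorem idempotent_mul_mem [Finite R] {f : R} (hf : f * f = f) (a : R) :
    f * (a * a - a) ∈ unitSpan R := by
  have hf' : f * (1 - f) = 0 := by rw [mul_sub, hf]; simp
  have hf'' : (1 - f) * f = 0 := by rw [sub_mul, hf]; simp
  have hg : (1 - f) * (1 - f) = 1 - f := by rw [sub_mul (1 : R) f, hf']; simp
  have hx (b : R) : f * b * (1 - f) * (f * b * (1 - f)) = 0 := by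
    calc _ = f * b * ((1 - f) * f) * b * (1 - f) := by simp only [mul_assoc]
      _ = 0 := by rw [hf'']; simp
  have hy (b : R) : (1 - f) * b * f * ((1 - f) * b * f) = 0 := by
    calc _ = (1 - f) * b * (f * (1 - f)) * b * f := by simp only [mul_assoc]
      _ = 0 := by rw [hf']; simp
  have h := add_mem (add_mem (mul_self_sub_self_mem (f * a * f))
    (mul_mem_of_mul_self_eq_zero (hx a) (hy a)))
    (mem_of_mul_self_eq_zero (hx (a * a - a)))
  have e : f * a * f * (f * a * f) - f * a * f + f * a * (1 - f) * ((1 - f) * a * f)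
      + f * (a * a - a) * (1 - f) = f * (a * a - a) := by
    have e1 : f * a * f * (f * a * f) = f * a * f * a * f := by
      calc _ = f * a * (f * f) * a * f := by simp only [mul_assoc]
        _ = _ := by rw [hf]
    have e2 : f * a * (1 - f) * ((1 - f) * a * f) = f * a * (1 - f) * a * f := by
      calc _ = f * a * ((1 - f) * (1 - f)) * a * f := by simp only [mul_assoc]
        _ = _ := by rw [hg]
    rw [e1, e2]
    noncomm_ring
  rwa [e] at h

/-- The additive span of the units of a finite ring contains the two-sided ideal generated by
the elements `a * a - a`. -/
theorem mul_mul_self_sub_self_mul_mem [Finite R] (b a c : R) :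
    b * ((a * a - a) * c) ∈ unitSpan R := by
  have left (b : R) : b * (a * a - a) ∈ unitSpan R := by
    obtain ⟨e, he, -, hu⟩ := exists_isIdempotentElem_commute_isUnit_sub b
    have h := add_mem (idempotent_mul_mem he a)
      (mul_mem_of_isUnit hu (mul_self_sub_self_mem a))
    rwa [← add_mul, add_sub_cancel] at h
  -- A commutator moves `c` to the left, where it is absorbed into `b`.
  have h := add_mem (mul_sub_mul_mem (b * (a * a - a)) c) (left (c * b))
  rw [mul_assoc c, sub_add_cancel] at h
  rwa [← mul_assoc]

end unitSpan

/-! ### Left ideals of order two -/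

section Generators

variable {R : Type*} [Ring R]

theorem ne_zero_of_mem_orderTwoGenerators {s : R} (hs : s ∈ orderTwoGenerators R) : s ≠ 0 := by
  rintro rfl
  have h : Nat.card (Ideal.span {(0 : R)} : Ideal R) = 2 := hs
  rw [Ideal.span_singleton_zero] at h
  simp at h

theorem eq_zero_or_eq_of_mem_orderTwoGenerators {s t : R} (hs : s ∈ orderTwoGenerators R)
    (ht : t ∈ Ideal.span {s}) : t = 0 ∨ t = s := by
  have h0 := ne_zero_of_mem_orderTwoGenerators hs
  have h : Nat.card (Ideal.span {s} : Ideal R) = 2 := hs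
  rw [Nat.card_eq_two_iff' (⟨0, zero_mem _⟩ : Ideal.span {s})] at h
  by_contra! hne
  have := h.unique (y₁ := ⟨t, ht⟩) (y₂ := ⟨s, Ideal.mem_span_singleton_self s⟩)
    (by simpa using hne.1) (by simpa using h0)
  exact hne.2 (by simpa using this)

theorem mem_orderTwoGenerators_of_forall {s : R} (h0 : s ≠ 0) (h : ∀ a : R, a * s = 0 ∨ a * s = s) :
    s ∈ orderTwoGenerators R := by
  change Nat.card (Ideal.span {s} : Ideal R) = 2
  rw [Nat.card_eq_two_iff' (⟨0, zero_mem _⟩ : Ideal.span {s})]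
  refine ⟨⟨s, Ideal.mem_span_singleton_self s⟩, by simpa using h0, ?_⟩
  rintro ⟨t, ht⟩ hne
  obtain ⟨a, rfl⟩ := Ideal.mem_span_singleton'.mp ht
  rcases h a with h | h
  · exact absurd (by simpa using h) hne
  · simpa using h

theorem unit_mul_orderTwoGenerator {s : R} (hs : s ∈ orderTwoGenerators R) (u : Rˣ) :
    (u : R) * s = s :=
  (eq_zero_or_eq_of_mem_orderTwoGenerators hs
    (Ideal.mem_span_singleton'.mpr ⟨u, rfl⟩)).resolve_left (by
      simpa using ne_zero_of_mem_orderTwoGenerators hs)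

/-- If `R` acts on `R x` through a Boolean quotient, then `x` is a sum of distinct generators of
left ideals of order two contained in `R x`. -/
theorem exists_sum_orderTwoGenerators [Finite R] (x : R)
    (hx : ∀ a c : R, (a * a - a) * (c * x) = 0) :
    ∃ T : Finset R, (T : Set R) ⊆ orderTwoGenerators R ∧ (T : Set R) ⊆ Ideal.span {x} ∧
      ∑ s ∈ T, s = x := by
  classical
  by_cases h0 : x = 0
  · exact ⟨∅, by simp, by simp, by simp [h0]⟩
  by_cases hsimple : ∀ a : R, a * x = 0 ∨ a * x = x
  · refine ⟨{x}, ?_, ?_, by simp⟩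
    · simpa using mem_orderTwoGenerators_of_forall h0 hsimple
    · simp
  push Not at hsimple
  obtain ⟨a, ha0, ha1⟩ := hsimple
  have idem (a c : R) : a * (a * (c * x)) = a * (c * x) := by
    have := hx a c
    rw [sub_mul, sub_eq_zero, mul_assoc] at this
    exact this
  have idem' (a : R) : a * (a * x) = a * x := by simpa using idem a 1
  have comm (a b : R) : a * (b * x) = b * (a * x) := by
    have h1 := idem' (a + b)
    -- For `-1` the expression `a * a - a` equals `2`, so `2` kills `Rx`.
    have h2 := hx (-1) (b * a)
    have h3 : a * (b * x) + b * (a * x) = 0 := by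
      have : (a + b) * ((a + b) * x) = a * (a * x) + b * (b * x) +
        (a * (b * x) + b * (a * x)) := by noncomm_ring
      rw [this, idem', idem', add_mul] at h1
      simpa using h1
    have h4 : b * (a * x) + b * (a * x) = 0 := by
      rw [← h2]; noncomm_ring
    exact add_right_cancel (h3.trans h4.symm)
  have hlt (a : R) (ha : a * x ≠ x) :
      Nat.card (Ideal.span {a * x} : Ideal R) < Nat.card (Ideal.span {x} : Ideal R) := by
    have hle : (Ideal.span {a * x} : Ideal R) ≤ Ideal.span {x} := by
      rw [Ideal.span_singleton_le_iff_mem]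
      exact Ideal.mul_mem_left _ _ (Ideal.mem_span_singleton_self x)
    refine Set.ncard_lt_ncard (s := (Ideal.span {a * x} : Set R)) (t := (Ideal.span {x} : Set R))
      ⟨hle, fun hge => ha ?_⟩ (Set.toFinite _)
    obtain ⟨b, hb⟩ := Ideal.mem_span_singleton'.mp (hge (Ideal.mem_span_singleton_self x))
    rw [← comm] at hb
    calc a * x = a * (a * (b * x)) := by rw [hb]
      _ = x := by rw [idem, hb]
  have hy : ∀ d c b : R, (c * c - c) * (b * (d * x)) = 0 := fun d c b => by
    rw [← mul_assoc b]; exact hx c _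
  -- Split `x = ax + (1 - a)x`; both summands generate strictly smaller left ideals.
  have ha2 : (1 - a) * x ≠ x := by simpa [sub_mul] using ha0
  have := hlt a ha1
  have := hlt (1 - a) ha2
  obtain ⟨T₁, hT₁, hs₁, he₁⟩ := exists_sum_orderTwoGenerators (a * x) (hy a)
  obtain ⟨T₂, hT₂, hs₂, he₂⟩ := exists_sum_orderTwoGenerators ((1 - a) * x) (hy (1 - a))
  have hle (d : R) : (Ideal.span {d * x} : Set R) ⊆ Ideal.span {x} := by
    have : (Ideal.span {d * x} : Ideal R) ≤ Ideal.span {x} := by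
      rw [Ideal.span_singleton_le_iff_mem]
      exact Ideal.mul_mem_left _ _ (Ideal.mem_span_singleton_self x)
    exact this
  -- `a` acts as the identity on `R(ax)` and as zero on `R((1 - a)x)`.
  have hdisj : Disjoint T₁ T₂ := by
    rw [Finset.disjoint_left]
    intro t ht₁ ht₂
    apply ne_zero_of_mem_orderTwoGenerators (hT₁ ht₁)
    obtain ⟨b, hb⟩ := Ideal.mem_span_singleton'.mp (hs₁ ht₁)
    obtain ⟨c, hc⟩ := Ideal.mem_span_singleton'.mp (hs₂ ht₂)
    have e1 : a * t = t := by rw [← hb, ← comm a b, idem]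
    have e2 : a * t = 0 := by
      rw [← hc, sub_mul, one_mul, mul_sub, mul_sub, ← comm a c, idem, sub_self]
    rw [← e1, e2]
  refine ⟨T₁ ∪ T₂, ?_, ?_, ?_⟩
  · rw [Finset.coe_union]; exact Set.union_subset hT₁ hT₂
  · rw [Finset.coe_union]
    exact Set.union_subset (hs₁.trans (hle _)) (hs₂.trans (hle _))
  · rw [Finset.sum_union hdisj, he₁, he₂, ← add_mul]; simp
termination_by Nat.card (Ideal.span {x} : Ideal R)

end Generators

/-! ### Generating characters and the weight -/

section Character

theorem homWeight_re_eq {R : Type*} [Ring R] {χ : AddChar R ℂ} [Fintype Rˣ] (x : R) :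
    (homWeight χ x).re = (Fintype.card Rˣ : ℝ)⁻¹ * ∑ u : Rˣ, (1 - (χ (u * x)).re) := by
  have hc : (Fintype.card Rˣ : ℝ) ≠ 0 := by simp
  rw [Finset.sum_sub_distrib, mul_sub]
  simp only [homWeight, finsum_eq_sum_of_fintype, Nat.card_eq_fintype_card]
  rw [show (1 / (Fintype.card Rˣ : ℂ)) = (((Fintype.card Rˣ : ℝ)⁻¹ : ℝ) : ℂ) by push_cast; simp]
  rw [Complex.sub_re, Complex.re_ofReal_mul, Complex.re_sum]
  simp [hc]

variable {R : Type*} [Ring R] [Finite R] {χ : AddChar R ℂ}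

/-- A generating character of a finite ring detects nonzero elements by left multiples. -/
theorem IsGeneratingCharacter.eq_zero_of_forall_mul (hχ : IsGeneratingCharacter χ) {x : R}
    (hx : ∀ a : R, χ (a * x) = 1) : x = 0 := by
  rcases hχ with hχ | hχ
  · have h := hχ (Ideal.span {x}) (by
      intro y hy
      obtain ⟨a, rfl⟩ := Ideal.mem_span_singleton'.mp hy
      exact hx a)
    simpa using h
  -- By counting, `r ↦ χ(r ·)` is a bijection onto all characters, and these separate points.
  · let φ : R → AddChar R ℂ := fun r => χ.compAddMonoidHom (AddMonoidHom.mulLeft r)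
    have hinj : Function.Injective φ := by
      intro r s h
      have h' := hχ (Submodule.span Rᵐᵒᵖ {r - s}) (by
        intro y hy
        obtain ⟨a, rfl⟩ := Submodule.mem_span_singleton.mp hy
        have := DFunLike.congr_fun h a.unop
        change χ (r * a.unop) = χ (s * a.unop) at this
        change χ ((r - s) * a.unop) = 1
        rw [sub_mul, AddChar.map_sub_eq_div, this,
          div_self (norm_ne_zero_iff.mp (by rw [AddChar.norm_apply]; exact one_ne_zero))])
      rw [Submodule.span_singleton_eq_bot] at h'
      exact sub_eq_zero.mp h'
    have hbij : Function.Bijective φ := by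
      have := Fintype.ofFinite R
      rw [Fintype.bijective_iff_injective_and_card]
      exact ⟨hinj, AddChar.card_eq.symm⟩
    rw [← AddChar.forall_apply_eq_zero]
    intro ψ
    obtain ⟨r, rfl⟩ := hbij.2 ψ
    exact hx r

/-- `2s = 0` forces `χ(s) = ±1`; the value `1` would make `χ` trivial on `Rs = {0, s}`. -/
theorem IsGeneratingCharacter.apply_orderTwoGenerator (hχ : IsGeneratingCharacter χ) {s : R}
    (hs : s ∈ orderTwoGenerators R) : χ s = -1 := by
  have h0 := ne_zero_of_mem_orderTwoGenerators hs
  have hmul (a : R) : a * s = 0 ∨ a * s = s :=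
    eq_zero_or_eq_of_mem_orderTwoGenerators hs (Ideal.mem_span_singleton'.mpr ⟨a, rfl⟩)
  have h2 : s + s = 0 := by
    rcases hmul 2 with h | h
    · rwa [two_mul] at h
    · rw [two_mul] at h
      exact absurd (by simpa using h) h0
  have h1 : χ s ≠ 1 := fun h1 => h0 <| hχ.eq_zero_of_forall_mul fun a => by
    rcases hmul a with h | h <;> simp [h, h1]
  have hsq : χ s * χ s = 1 := by rw [← AddChar.map_add_eq_mul, h2, AddChar.map_zero_eq_one]
  exact (mul_self_eq_one_iff.mp hsq).resolve_left h1

theorem IsGeneratingCharacter.apply_sum_orderTwoGenerators (hχ : IsGeneratingCharacter χ)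
    {T : Finset R} (hT : (T : Set R) ⊆ orderTwoGenerators R) :
    χ (∑ s ∈ T, s) = (-1) ^ T.card := by
  classical
  induction T using Finset.induction_on with
  | empty => simp
  | insert s T hs ih =>
    rw [Finset.coe_insert, Set.insert_subset_iff] at hT
    rw [Finset.sum_insert hs, AddChar.map_add_eq_mul, hχ.apply_orderTwoGenerator hT.1, ih hT.2,
      Finset.card_insert_of_notMem hs, pow_succ']

theorem IsGeneratingCharacter.mem_evenSums_iff (hχ : IsGeneratingCharacter χ) (x : R) :
    x ∈ evenSums R ↔ ∀ u : Rˣ, χ (u * x) = 1 := by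
  constructor
  · rintro ⟨T, hT, heven, rfl⟩ u
    rw [Finset.mul_sum, Finset.sum_congr rfl fun s hs => unit_mul_orderTwoGenerator (hT hs) u,
      hχ.apply_sum_orderTwoGenerators hT, heven.neg_one_pow]
  · intro hx
    have hspan : ∀ g ∈ unitSpan R, χ (g * x) = 1 := by
      intro g hg
      induction hg using AddSubgroup.closure_induction with
      | mem v hv => obtain ⟨u, rfl⟩ := hv; exact hx u
      | zero => simp
      | add a b _ _ ha hb => rw [add_mul, AddChar.map_add_eq_mul, ha, hb, one_mul]
      | neg a _ ha => rw [neg_mul, AddChar.map_neg_eq_inv, ha, inv_one]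
    obtain ⟨T, hT, -, hsum⟩ := exists_sum_orderTwoGenerators x fun a c =>
      hχ.eq_zero_of_forall_mul fun b => by
        rw [← mul_assoc _ c, ← mul_assoc b]
        exact hspan _ (unitSpan.mul_mul_self_sub_self_mul_mem b a c)
    refine ⟨T, hT, ?_, hsum⟩
    have h1 : χ x = 1 := by simpa using hx 1
    rw [← hsum, hχ.apply_sum_orderTwoGenerators hT] at h1
    exact (neg_one_pow_eq_one_iff_even (by norm_num)).mp h1

theorem conj_homWeight (x : R) : conj (homWeight χ x) = homWeight χ x := by
  have := Fintype.ofFinite Rˣ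
  simp only [homWeight, finsum_eq_sum_of_fintype, map_sub, map_mul, map_div₀, map_one, map_natCast,
    map_sum]
  congr 2
  -- Conjugating `χ` negates its argument, and `u ↦ -u` permutes the units.
  rw [← Equiv.sum_comp (Equiv.neg Rˣ)]
  refine Finset.sum_congr rfl fun u _ => ?_
  rw [← AddChar.map_neg_eq_conj]
  simp

theorem one_sub_re_apply_nonneg (y : R) : 0 ≤ 1 - (χ y).re := by
  have := Complex.re_le_norm (χ y)
  rw [AddChar.norm_apply] at this
  linarith

theorem homWeight_eq_zero_iff (x : R) : homWeight χ x = 0 ↔ ∀ u : Rˣ, χ (u * x) = 1 := by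
  have := Fintype.ofFinite Rˣ
  have hc : (Fintype.card Rˣ : ℝ) ≠ 0 := by simp
  have him : (homWeight χ x).im = 0 := Complex.conj_eq_iff_im.mp (conj_homWeight x)
  rw [Complex.ext_iff, him, homWeight_re_eq]
  simp only [Complex.zero_re, Complex.zero_im, and_true, mul_eq_zero, inv_eq_zero, hc, false_or]
  rw [Finset.sum_eq_zero_iff_of_nonneg fun u _ => one_sub_re_apply_nonneg _]
  refine ⟨fun h u => ?_, fun h u _ => by simp [h u]⟩
  have hre : (χ (u * x)).re = 1 := by linarith [h u (Finset.mem_univ u)]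
  have hn : ‖χ (u * x)‖ = 1 := AddChar.norm_apply _ _
  -- A number of norm `1` with real part `1` is `1`.
  have hre' : (χ (u * x)).re = ‖χ (u * x)‖ := by rw [hre, hn]
  obtain ⟨-, him⟩ := Complex.nonneg_iff.mp (Complex.re_eq_norm.mp hre')
  exact Complex.ext (by simpa using hre) (by simpa using him.symm)

end Character

/-- For a finite Frobenius ring `R` and any generating character `χ` used to define its homogeneous
weight `w`: `w` is real and nonnegative, its zero set is `S₀`, and `w` is invariant under
translation by `S₀`. -/
theorem mainTheorem7 {R : Type*} [Ring R] [Finite R] (χ : AddChar R ℂ)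
    (hχ : IsGeneratingCharacter χ) :
    (∀ x : R, (homWeight χ x).im = 0 ∧ 0 ≤ (homWeight χ x).re) ∧
    evenSums R = {x : R | homWeight χ x = 0} ∧
    ∀ x : R, ∀ y ∈ evenSums R, homWeight χ (x + y) = homWeight χ x := by
  refine ⟨fun x => ⟨Complex.conj_eq_iff_im.mp (conj_homWeight x), ?_⟩, ?_, fun x y hy => ?_⟩
  · have := Fintype.ofFinite Rˣ
    rw [homWeight_re_eq]
    exact mul_nonneg (by positivity) (Finset.sum_nonneg fun u _ => one_sub_re_apply_nonneg _)
  · ext x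
    rw [Set.mem_ofPred_eq, homWeight_eq_zero_iff, hχ.mem_evenSums_iff]
  · rw [hχ.mem_evenSums_iff] at hy
    simp only [homWeight, mul_add, AddChar.map_add_eq_mul, hy, mul_one]
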